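/- Let $N\ge 2$, let $\omega\subset\mathbb{R}^{N-1}$ be a bounded domain (nonempty, open, connected) with smooth boundary, and let $\mathcal{C}_\omega=\omega\times(0,\infty)\subset\mathbb{R}^N$ be the half-cylinder spanned by $\omega$. Let $\varphi\in C^2(\overline{\omega})$ with $\varphi>0$ on $\overline\omega$, and put $$\Gamma_\varphi=\{(x',x_N): x'\in\omega,\ x_N=\varphi(x')\},\qquad \Omega_\varphi=\{(x',x_N): x'\in\omega,\ 0<x_N<\varphi(x')\}.$$ Let $\nu=(-\nabla\varphi,1)/\sqrt{1+|\nabla\varphi|^2}$ be the unit normal to $\Gamma_\varphi$ exterior to $\Omega_\varphi$, and let $H_{\Gamma_\varphi}=\frac{1}{N-1}\operatorname{div}_{\Gamma_\varphi}\nu$ be the mean curvature of $\Gamma_\varphi$ with respect to $\nu$, i.e. $H_{\Gamma_\varphi}(x',\varphi(x'))=-\frac1{N-1}\operatorname{div}\bigl(\nabla\varphi/\sqrt{1+|\nabla\varphi|^2}\bigr)(x')$ for $x'\in\omega$. Assume that $\Gamma_\varphi$ meets $\partial\mathcal{C}_\omega$ orthogonally, i.e. at every point of $\overline{\Gamma_\varphi}\cap\partial\mathcal{C}_\omega$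 the normal $\nu$ is orthogonal to the outer unit normal of $\partial\mathcal{C}_\omega$. For a measurable set $E\subseteq\mathcal{C}_\omega$ let $|E|$ be its Lebesgue measure and $$P_{\mathcal{C}_\omega}(E)=\sup\Bigl\{\int_E\operatorname{div}\psi\,dx:\ \psi\in C^1_c(\mathcal{C}_\omega,\mathbb{R}^N),\ \|\psi\|_\infty\le 1\Bigr\}$$ its perimeter relative to $\mathcal{C}_\omega$. Assume that $\Omega_\varphi$ is self-Cheeger relative to $\mathcal{C}_\omega$, i.e. $$\frac{P_{\mathcal{C}_\omega}(\Omega_\varphi)}{|\Omega_\varphi|}=\inf\Bigl\{\frac{P_{\mathcal{C}_\omega}(E)}{|E|}:\ E\subseteq\Omega_\varphi\text{ measurable},\ |E|>0\Bigr\}.$$ Then $P_{\mathcal{C}_\omega}(\Omega_\varphi)<\infty$ and, at every point of $\Gamma_\varphi$, $$H_{\Gamma_\varphi}\le\frac{P_{\mathcal{C}_\omega}(\Omega_\varphi)}{(N-1)\,|\Omega_\varphi|}.$$ -/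

import Mathlib

open MeasureTheory
open scoped ENNReal

namespace RelCheeger

/-- `ℝᵐ` with its Euclidean norm and Lebesgue measure. -/
abbrev Euc (m : ℕ) : Type := EuclideanSpace ℝ (Fin m)

/-! ### Smooth domains and outer normals -/

/-- `ρ` is a smooth local defining function of the set `D` at the boundary point `p`, on the open
neighbourhood `U` of `p`: inside `U`, the set `D` is `{ρ < 0}`, and `∇ρ` does not vanish. -/
structure IsLocalDefiningFunction {m : ℕ} (D : Set (Euc m)) (p : Euc m)
    (U : Set (Euc m)) (ρ : Euc m → ℝ) : Prop where
  isOpen : IsOpen U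
  mem : p ∈ U
  smooth : ContDiffOn ℝ ((⊤ : ℕ∞) : WithTop ℕ∞) ρ U
  zero : ρ p = 0
  gradient_ne_zero : ∀ y ∈ U, gradient ρ y ≠ 0
  inter_eq : D ∩ U = {y ∈ U | ρ y < 0}

/-- A bounded domain (nonempty, open, connected) with `C^∞` boundary. -/
structure IsSmoothBoundedDomain {m : ℕ} (D : Set (Euc m)) : Prop where
  isOpen : IsOpen D
  isConnected : IsConnected D
  isBounded : Bornology.IsBounded D
  smooth_boundary : ∀ p ∈ frontier D, ∃ U ρ, IsLocalDefiningFunction D p U ρ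

/-- `v` is the outer unit normal to `∂D` at `p`, a point near which `∂D` is smooth. -/
def IsOuterUnitNormal {m : ℕ} (D : Set (Euc m)) (p v : Euc m) : Prop :=
  ∃ U ρ, IsLocalDefiningFunction D p U ρ ∧ v = ‖gradient ρ p‖⁻¹ • gradient ρ p

/-! ### Relative perimeter and relative Cheeger sets -/

/-- The divergence `∑ᵢ ∂ᵢ ψᵢ` of a vector field. -/
noncomputable def divergence {m : ℕ} (ψ : Euc m → Euc m) (x : Euc m) : ℝ :=
  ∑ i : Fin m, (fderiv ℝ ψ x (EuclideanSpace.single i 1)) i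

/-- Test fields for the perimeter relative to `C`: `ψ ∈ C¹_c(C, ℝᵐ)` with `‖ψ‖_∞ ≤ 1`. -/
structure IsTestField {m : ℕ} (C : Set (Euc m)) (ψ : Euc m → Euc m) : Prop where
  contDiff : ContDiff ℝ 1 ψ
  hasCompactSupport : HasCompactSupport ψ
  tsupport_subset : tsupport ψ ⊆ C
  norm_le_one : ∀ x, ‖ψ x‖ ≤ 1

/-- The perimeter of (a measurable set) `E` relative to `C`, the supremum of `∫_E div ψ` over the
test fields `ψ`. Test fields are stable under `ψ ↦ -ψ`, so that passing to the positive part of the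
integral (`ENNReal.ofReal`) does not change the supremum. -/
noncomputable def relPerimeter {m : ℕ} (C E : Set (Euc m)) : ℝ≥0∞ :=
  ⨆ (ψ : Euc m → Euc m) (_ : IsTestField C ψ), ENNReal.ofReal (∫ x in E, divergence ψ x)

/-- The competitors for the relative Cheeger constant: the measurable subsets of `Ω` for which the
quotient of perimeter and volume makes sense. -/
structure IsCompetitor {m : ℕ} (Ω E : Set (Euc m)) : Prop where
  measurableSet : MeasurableSet E
  subset : E ⊆ Ω
  volume_ne_zero : volume E ≠ 0
  volume_ne_top : volume E ≠ ∞

/-- The Cheeger constant of `Ω` relative to `C`. -/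
noncomputable def relCheegerConstant {m : ℕ} (C Ω : Set (Euc m)) : ℝ≥0∞ :=
  ⨅ (E : Set (Euc m)) (_ : IsCompetitor Ω E), relPerimeter C E / volume E

/-- `E` is a Cheeger set of `Ω` relative to `C`. -/
def IsRelCheegerSet {m : ℕ} (C Ω E : Set (Euc m)) : Prop :=
  IsCompetitor Ω E ∧ relPerimeter C E / volume E = relCheegerConstant C Ω

/-- `Ω` is self-Cheeger relative to `C`. -/
def IsSelfCheeger {m : ℕ} (C Ω : Set (Euc m)) : Prop :=
  IsRelCheegerSet C Ω Ω

/-! ### Cylinders and graphs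

Points of `ℝ^(n+1)` are written `(x', x_N)` with `N = n + 1`, `x' ∈ ℝⁿ` and `x_N` the last
coordinate. -/

/-- The point `(y, t)` of `ℝ^(n+1)`. -/
noncomputable def pair {n : ℕ} (y : Euc n) (t : ℝ) : Euc (n + 1) :=
  WithLp.toLp 2 (Fin.snoc (α := fun _ => ℝ) (fun i => y i) t)

/-- The projection `(x', x_N) ↦ x'`. -/
noncomputable def base {n : ℕ} (x : Euc (n + 1)) : Euc n :=
  WithLp.toLp 2 (fun i => x i.castSucc)

/-- The last coordinate `(x', x_N) ↦ x_N`. -/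
def height {n : ℕ} (x : Euc (n + 1)) : ℝ := x (Fin.last n)

/-- The half-cylinder `ω × (0, ∞)`. -/
def halfCylinder {n : ℕ} (ω : Set (Euc n)) : Set (Euc (n + 1)) :=
  {x | base x ∈ ω ∧ 0 < height x}

/-- The cartesian graph `Γ_φ` of `φ` over `ω`. -/
def graph {n : ℕ} (ω : Set (Euc n)) (φ : Euc n → ℝ) : Set (Euc (n + 1)) :=
  {x | base x ∈ ω ∧ height x = φ (base x)}

/-- The domain `Ω_φ`, the part of the half-cylinder below the graph of `φ`. -/
def subgraph {n : ℕ} (ω : Set (Euc n)) (φ : Euc n → ℝ) : Set (Euc (n + 1)) :=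
  {x ∈ halfCylinder ω | height x < φ (base x)}

/-- The exterior unit normal `(-∇φ(x'), 1) / √(1 + |∇φ(x')|²)` of `Ω_φ` along the closure of
`Γ_φ`, extended independently of `x_N`. The gradient is taken within the closure of `ω`, so that it
is also meaningful on `∂ω`. -/
noncomputable def graphNormal {n : ℕ} (ω : Set (Euc n)) (φ : Euc n → ℝ) (x : Euc (n + 1)) :
    Euc (n + 1) :=
  (Real.sqrt (1 + ‖gradientWithin φ (closure ω) (base x)‖ ^ 2))⁻¹ •
    pair (-gradientWithin φ (closure ω) (base x)) 1

/-- The graph of `φ` meets the boundary of the cylinder orthogonally: the two normals are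
orthogonal at all common points. -/
def MeetsOrthogonally {n : ℕ} (ω : Set (Euc n)) (φ : Euc n → ℝ) : Prop :=
  ∀ x ∈ closure (graph ω φ) ∩ frontier (halfCylinder ω), ∀ v, IsOuterUnitNormal (halfCylinder ω) x v →
    inner ℝ (graphNormal ω φ x) v = 0

/-- The mean curvature at `x`, with respect to the unit normal `ν` (extended to a neighbourhood of
`x`), of a hypersurface of `ℝ^(n+1)`: the tangential divergence of `ν`, that is, the trace of the
derivative of `ν` on the orthogonal complement of `ν x`, divided by the dimension `n`.
It is `1 / r` for a sphere of radius `r` and its outer normal. -/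
noncomputable def meanCurvature {n : ℕ} (ν : Euc (n + 1) → Euc (n + 1)) (x : Euc (n + 1)) : ℝ :=
  (divergence ν x - inner ℝ (fderiv ℝ ν x (ν x)) (ν x)) / n

end RelCheeger

open RelCheeger

/-! Only downward perturbations of the graph stay inside `Ω_φ`, so minimality of the Cheeger
quotient gives a one-sided Euler–Lagrange inequality. Write `A = √(1 + |∇φ|²)`, `V = -∇φ / A`, `P`
and `M` for the relative perimeter and volume of `Ω_φ`. For a cutoff `0 ≤ η ≤ 1` with compact
support in `ω` and `0 < ε < min φ`, the subgraph of `φ - εη` is a competitor. Its volume is `M - ε ∫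
η`, and its perimeter is at most `P + ε ∫ ⟨V, ∇η⟩ + ε² ∫ |∇η|²`. Comparing quotients, dividing by
`ε` and letting `ε → 0⁺` yields `-∫ ⟨V, ∇η⟩ ≤ (P / M) ∫ η` (`first_variation_le`). After integration
by parts this is `∫ η (div V - P / M) ≤ 0`, and concentrating `η` near a point forces `div V ≤ P /
M` there (`divergence_horizontalNormal_le`). Finally `div V = n H` (`meanCurvature_graphNormal`).

The geometric input is the area formula `P = ∫_ω A` (`relPerimeter_subgraph`), derived from a
divergence theorem below graphs. Equality is needed for `φ` itself; for the competitors the upper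
bound suffices. Finiteness of `P` follows from comparison with a flat subgraph of height `min φ`. -/

namespace RelCheeger

open Set Filter Topology

/-! ### Coordinates -/

section Coordinates

variable {n : ℕ}

@[simp]
theorem pair_castSucc (y : Euc n) (t : ℝ) (i : Fin n) : pair y t i.castSucc = y i := by
  simp [pair]

@[simp]
theorem pair_last (y : Euc n) (t : ℝ) : pair y t (Fin.last n) = t := by
  simp [pair]

@[simp]
theorem base_pair (y : Euc n) (t : ℝ) : base (pair y t) = y := by
  ext i; simp [base]

@[simp]
theorem height_pair (y : Euc n) (t : ℝ) : height (pair y t) = t := by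
  simp [height]

@[simp]
theorem pair_base_height (x : Euc (n + 1)) : pair (base x) (height x) = x := by
  ext i
  refine Fin.lastCases ?_ (fun j => ?_) i
  · simp [height]
  · simp [base]

theorem contDiff_pair {k : WithTop ℕ∞} : ContDiff ℝ k (fun p : Euc n × ℝ => pair p.1 p.2) := by
  rw [contDiff_euclidean]
  intro i
  refine Fin.lastCases ?_ (fun j => ?_) i
  · simp only [pair_last]; fun_prop
  · simp only [pair_castSucc]; fun_prop

theorem contDiff_base {k : WithTop ℕ∞} : ContDiff ℝ k (base : Euc (n + 1) → Euc n) := by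
  rw [contDiff_euclidean]
  intro i
  simp only [base]; fun_prop

theorem contDiff_height {k : WithTop ℕ∞} : ContDiff ℝ k (height : Euc (n + 1) → ℝ) := by
  unfold height; fun_prop

theorem continuous_pair : Continuous (fun p : Euc n × ℝ => pair p.1 p.2) :=
  (contDiff_pair (k := 0)).continuous

theorem continuous_base : Continuous (base : Euc (n + 1) → Euc n) :=
  (contDiff_base (k := 0)).continuous

theorem continuous_height : Continuous (height : Euc (n + 1) → ℝ) :=
  (contDiff_height (k := 0)).continuous

theorem pair_eq_add (v : Euc n) (a : ℝ) :
    pair v a = pair v 0 + a • EuclideanSpace.single (Fin.last n) 1 := by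
  ext i
  refine Fin.lastCases ?_ (fun j => ?_) i
  · simp
  · simp

theorem pair_single (i : Fin n) :
    pair (EuclideanSpace.single i 1) 0 = EuclideanSpace.single i.castSucc (1 : ℝ) := by
  ext j
  refine Fin.lastCases ?_ (fun k => ?_) j
  · simp
  · simp

theorem inner_pair (y z : Euc n) (s t : ℝ) :
    inner ℝ (pair y s) (pair z t) = inner ℝ y z + s * t := by
  simp [PiLp.inner_apply, Fin.sum_univ_castSucc, mul_comm]

theorem norm_pair_sq (y : Euc n) (t : ℝ) : ‖pair y t‖ ^ 2 = ‖y‖ ^ 2 + t ^ 2 := by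
  rw [← real_inner_self_eq_norm_sq, inner_pair, real_inner_self_eq_norm_sq, sq t]

theorem hasFDerivAt_pair (p : Euc n × ℝ) :
    ∃ L : Euc n × ℝ →L[ℝ] Euc (n + 1), HasFDerivAt (fun p : Euc n × ℝ => pair p.1 p.2) L p ∧
      ∀ q, L q = pair q.1 q.2 := by
  let L : Euc n × ℝ →ₗ[ℝ] Euc (n + 1) :=
    { toFun := fun p => pair p.1 p.2
      map_add' := fun p q => by
        ext i; refine Fin.lastCases ?_ (fun j => ?_) i <;> simp
      map_smul' := fun r p => by
        ext i; refine Fin.lastCases ?_ (fun j => ?_) i <;> simp }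
  exact ⟨L.toContinuousLinearMap, L.toContinuousLinearMap.hasFDerivAt, fun _ => rfl⟩

theorem hasFDerivAt_base (x : Euc (n + 1)) :
    ∃ L : Euc (n + 1) →L[ℝ] Euc n, HasFDerivAt base L x ∧ ∀ z, L z = base z := by
  let L : Euc (n + 1) →ₗ[ℝ] Euc n :=
    { toFun := base
      map_add' := fun p q => by ext i; simp [base]
      map_smul' := fun r p => by ext i; simp [base] }
  exact ⟨L.toContinuousLinearMap, L.toContinuousLinearMap.hasFDerivAt, fun _ => rfl⟩

/-- The splitting `ℝ^(n+1) ≃ ℝⁿ × ℝ` as a measurable equivalence. -/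
noncomputable def pairEquiv (n : ℕ) : Euc n × ℝ ≃ᵐ Euc (n + 1) where
  toFun p := pair p.1 p.2
  invFun x := (base x, height x)
  left_inv p := by simp
  right_inv x := by simp
  measurable_toFun := continuous_pair.measurable
  measurable_invFun := (continuous_base.prodMk continuous_height).measurable

theorem measurePreserving_pairEquiv (n : ℕ) : MeasurePreserving (pairEquiv n) := by
  have h1 := (volume_preserving_piFinSuccAbove (fun _ : Fin (n + 1) => ℝ) (Fin.last n)).symm
  have h2 : MeasurePreserving (Prod.swap : Euc n × ℝ → ℝ × Euc n) :=
    Measure.measurePreserving_swap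
  have h3 : MeasurePreserving
      (Prod.map id WithLp.ofLp : ℝ × Euc n → ℝ × (Fin n → ℝ)) :=
    (MeasurePreserving.id volume).prod (PiLp.volume_preserving_ofLp (Fin n))
  have h4 := PiLp.volume_preserving_toLp (Fin (n + 1))
  have h := h4.comp (h1.comp (h3.comp h2))
  convert h using 1
  ext p i
  refine Fin.lastCases ?_ (fun j => ?_) i
  · simp [pairEquiv, MeasurableEquiv.piFinSuccAbove, Fin.insertNthEquiv]
  · simp [pairEquiv, MeasurableEquiv.piFinSuccAbove, Fin.insertNthEquiv]

theorem integral_pair (f : Euc (n + 1) → ℝ) :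
    ∫ x, f x = ∫ p : Euc n × ℝ, f (pair p.1 p.2) :=
  ((measurePreserving_pairEquiv n).integral_comp' (g := f)).symm

end Coordinates

/-! ### Cutoff functions -/

/-- Being 1 near each point of `K`, and not merely on `K`, lets products with `χ` keep their
derivatives on `K`. Of the two nested compact sets, `K₁` carries the value 1 and `K₂` contains the
support. -/
theorem exists_cutoff {m : ℕ} {K U : Set (Euc m)} (hK : IsCompact K) (hU : IsOpen U)
    (hKU : K ⊆ U) :
    ∃ χ : Euc m → ℝ, ContDiff ℝ 2 χ ∧ HasCompactSupport χ ∧ tsupport χ ⊆ U ∧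
      (∀ x ∈ K, χ =ᶠ[𝓝 x] fun _ => 1) ∧ ∀ x, χ x ∈ Icc (0 : ℝ) 1 := by
  obtain ⟨K₁, hK₁, hKK₁, hK₁U⟩ := exists_compact_between hK hU hKU
  obtain ⟨K₂, hK₂, hKK₂, hK₂U⟩ := exists_compact_between hK₁ hU hK₁U
  obtain ⟨f, hf0, hf1, hf⟩ := exists_contMDiffMap_zero_one_of_isClosed (n := 2)
    (modelWithCornersSelf ℝ (Euc m)) (s := (interior K₂)ᶜ) (t := K₁)
    isOpen_interior.isClosed_compl hK₁.isClosed
    (disjoint_compl_left_iff_subset.2 hKK₂)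
  have hsupp : tsupport f ⊆ K₂ := by
    refine closure_minimal (fun x hx => ?_) hK₂.isClosed
    by_contra hx2
    exact hx (hf0 (fun h => hx2 (interior_subset h)))
  refine ⟨f, f.contMDiff.contDiff, hK₂.of_isClosed_subset (isClosed_tsupport _) hsupp,
    hsupp.trans hK₂U, fun x hx => ?_, hf⟩
  filter_upwards [mem_interior_iff_mem_nhds.1 (hKK₁ hx)] with z hz
  exact hf1 hz

theorem contDiff_of_tsupport_subset {E F : Type*} [NormedAddCommGroup E] [NormedSpace ℝ E]
    [NormedAddCommGroup F] [NormedSpace ℝ F] {k : WithTop ℕ∞} {U : Set E} (hU : IsOpen U)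
    {f : E → F} (hf : ContDiffOn ℝ k f U) (hsupp : tsupport f ⊆ U) : ContDiff ℝ k f := by
  refine contDiff_iff_contDiffAt.2 fun x => ?_
  by_cases hx : x ∈ tsupport f
  · exact hf.contDiffAt (hU.mem_nhds (hsupp hx))
  · exact contDiffAt_const.congr_of_eventuallyEq (notMem_tsupport_iff_eventuallyEq.1 hx)

/-! ### The divergence theorem on the region below a graph -/

section BelowGraph

variable {n : ℕ}

theorem continuous_shear {g : Euc n → ℝ} (hg : Continuous g) :
    Continuous (fun p : Euc n × ℝ => pair p.1 (p.2 + g p.1)) :=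
  continuous_pair.comp (by fun_prop : Continuous fun p : Euc n × ℝ => (p.1, p.2 + g p.1))

theorem hasCompactSupport_shear {g : Euc n → ℝ} (hg : Continuous g) {h : Euc (n + 1) → ℝ}
    (hs : HasCompactSupport h) :
    HasCompactSupport (fun p : Euc n × ℝ => h (pair p.1 (p.2 + g p.1))) := by
  have hc : Continuous fun x : Euc (n + 1) => (base x, height x - g (base x)) :=
    continuous_base.prodMk (continuous_height.sub (hg.comp continuous_base))
  refine HasCompactSupport.intro (IsCompact.image hs hc) fun p hp => ?_
  refine image_eq_zero_of_notMem_tsupport fun h' => hp ⟨_, h', ?_⟩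
  simp

/-- The shear `s = x_N - g(x')` preserves volume and flattens the region to the half-space `s < 0`.
-/
theorem setIntegral_below_graph {g : Euc n → ℝ} (hg : Continuous g) {h : Euc (n + 1) → ℝ}
    (hh : Continuous h) (hs : HasCompactSupport h) :
    ∫ x in {x | height x < g (base x)}, h x
      = ∫ y, ∫ s in Iio (0 : ℝ), h (pair y (s + g y)) := by
  have hmeas : MeasurableSet {x : Euc (n + 1) | height x < g (base x)} :=
    (isOpen_lt continuous_height (hg.comp continuous_base)).measurableSet
  have hint : Integrable (indicator {x : Euc (n + 1) | height x < g (base x)} h) :=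
    (hh.integrable_of_hasCompactSupport hs).indicator hmeas
  have hint' : Integrable (fun p : Euc n × ℝ =>
      indicator {x : Euc (n + 1) | height x < g (base x)} h (pair p.1 p.2)) :=
    (measurePreserving_pairEquiv n).integrable_comp_of_integrable hint
  rw [← integral_indicator hmeas, integral_pair, Measure.volume_eq_prod, integral_prod _ hint']
  refine integral_congr_ae (Eventually.of_forall fun y => ?_)
  simp only
  rw [← integral_add_right_eq_self _ (g y), ← integral_indicator measurableSet_Iio]
  refine integral_congr_ae (Eventually.of_forall fun s => ?_)
  by_cases hs0 : s < 0 <;> simp [indicator, hs0]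

theorem setIntegral_below_graph_swap {g : Euc n → ℝ} (hg : Continuous g) {h : Euc (n + 1) → ℝ}
    (hh : Continuous h) (hs : HasCompactSupport h) :
    ∫ x in {x | height x < g (base x)}, h x
      = ∫ s in Iio (0 : ℝ), ∫ y, h (pair y (s + g y)) := by
  rw [setIntegral_below_graph hg hh hs]
  have hint : Integrable (fun p : Euc n × ℝ => h (pair p.1 (p.2 + g p.1)))
      (volume.prod volume) :=
    (hh.comp (continuous_shear hg)).integrable_of_hasCompactSupport (hasCompactSupport_shear hg hs)
  refine integral_integral_swap (f := fun y s => h (pair y (s + g y))) ?_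
  refine hint.mono_measure ?_
  exact Measure.prod_mono le_rfl Measure.restrict_le_self

theorem hasCompactSupport_slice {X Y : Type*} [TopologicalSpace X] [TopologicalSpace Y]
    [T2Space Y] {f : X → ℝ} (hf : HasCompactSupport f) {e : Y → X} {r : X → Y}
    (hr : Continuous r) (hre : ∀ y, r (e y) = y) : HasCompactSupport fun y => f (e y) := by
  refine HasCompactSupport.intro (IsCompact.image hf hr) fun y hy => ?_
  exact image_eq_zero_of_notMem_tsupport fun h' => hy ⟨_, h', hre y⟩

theorem integral_fderiv_eq_zero {m : ℕ} {f : Euc m → ℝ} (hf : ContDiff ℝ 1 f)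
    (hs : HasCompactSupport f) (v : Euc m) : ∫ x, fderiv ℝ f x v = 0 := by
  have hc : Continuous fun x => fderiv ℝ f x v :=
    (hf.continuous_fderiv one_ne_zero).clm_apply continuous_const
  -- Integration by parts against the constant function 1.
  have h := integral_mul_fderiv_eq_neg_fderiv_mul_of_integrable (μ := volume)
    (f := fun _ : Euc m => (1 : ℝ)) (g := f) (v := v) (by simp)
    (by simpa using hc.integrable_of_hasCompactSupport (hs.fderiv_apply ℝ v))
    (by simpa using hf.continuous.integrable_of_hasCompactSupport hs)
    (fun x _ => by fun_prop) (fun x _ => (hf.differentiable one_ne_zero) x)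
  simpa using h

theorem setIntegral_Iio_fderiv_last {f : Euc (n + 1) → ℝ} (hf : ContDiff ℝ 1 f)
    (hs : HasCompactSupport f) (y : Euc n) (a : ℝ) :
    ∫ s in Iio (0 : ℝ), fderiv ℝ f (pair y (s + a)) (EuclideanSpace.single (Fin.last n) 1)
      = f (pair y a) := by
  have hd : ∀ s, HasDerivAt (fun s => f (pair y (s + a)))
      (fderiv ℝ f (pair y (s + a)) (EuclideanSpace.single (Fin.last n) 1)) s := by
    intro s
    obtain ⟨L, hL, hLa⟩ := hasFDerivAt_pair (y, s + a)
    have h1 := ((hf.differentiable one_ne_zero) (pair y (s + a))).hasFDerivAt.comp (y, s + a) hL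
    have h2 : HasDerivAt (fun s : ℝ => (y, s + a)) ((0 : Euc n), (1 : ℝ)) s :=
      (hasDerivAt_const s y).prodMk ((hasDerivAt_id s).add_const a)
    have h3 := h1.comp_hasDerivAt s h2
    have h4 : pair (0 : Euc n) 1 = EuclideanSpace.single (Fin.last n) (1 : ℝ) := by
      ext i
      refine Fin.lastCases ?_ (fun j => ?_) i <;> simp
    rw [ContinuousLinearMap.comp_apply, hLa, h4] at h3
    exact h3
  have hC : ContDiff ℝ 1 fun s => f (pair y (s + a)) :=
    hf.comp (contDiff_pair.comp (by fun_prop : ContDiff ℝ 1 fun s : ℝ => (y, s + a)))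
  have hS : HasCompactSupport fun s => f (pair y (s + a)) :=
    hasCompactSupport_slice hs (r := fun x => height x - a) (e := fun s => pair y (s + a))
      (continuous_height.sub continuous_const) (by simp)
  have := hS.integral_Iic_deriv_eq hC 0
  rw [← integral_Iic_eq_integral_Iio]
  simpa [(hd _).deriv] using this

theorem setIntegral_below_graph_fderiv_last {g : Euc n → ℝ} (hg : Continuous g)
    {f : Euc (n + 1) → ℝ} (hf : ContDiff ℝ 1 f) (hs : HasCompactSupport f) :
    ∫ x in {x | height x < g (base x)}, fderiv ℝ f x (EuclideanSpace.single (Fin.last n) 1)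
      = ∫ y, f (pair y (g y)) := by
  rw [setIntegral_below_graph hg
    ((hf.continuous_fderiv one_ne_zero).clm_apply continuous_const) (hs.fderiv_apply ℝ _)]
  simp_rw [setIntegral_Iio_fderiv_last hf hs]

/-- In sheared coordinates the `i`-th derivative of `y ↦ f (y, s + g y)` is `∂ᵢf + ∂ᵢg ∂_N f`, which
integrates to zero on each slice. What remains is the vertical derivative, evaluated on the graph by
the fundamental theorem of calculus. -/
theorem setIntegral_below_graph_fderiv_castSucc {g : Euc n → ℝ} (hg : ContDiff ℝ 1 g)
    {f : Euc (n + 1) → ℝ} (hf : ContDiff ℝ 1 f) (hs : HasCompactSupport f) (i : Fin n) :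
    ∫ x in {x | height x < g (base x)}, fderiv ℝ f x (EuclideanSpace.single i.castSucc 1)
      = - ∫ y, fderiv ℝ g y (EuclideanSpace.single i 1) * f (pair y (g y)) := by
  set e : Euc (n + 1) := EuclideanSpace.single i.castSucc 1 with he
  set eN : Euc (n + 1) := EuclideanSpace.single (Fin.last n) 1 with heN
  set v : Euc n := EuclideanSpace.single i 1 with hv
  have hcf : ∀ w, Continuous fun x => fderiv ℝ f x w := fun w =>
    (hf.continuous_fderiv one_ne_zero).clm_apply continuous_const
  have hcg : Continuous fun x : Euc (n + 1) => fderiv ℝ g (base x) v :=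
    ((hg.continuous_fderiv one_ne_zero).clm_apply continuous_const).comp continuous_base
  have hint1 := (hcf e).integrable_of_hasCompactSupport (μ := volume) (hs.fderiv_apply ℝ e)
  have hc2 : Continuous fun x => fderiv ℝ g (base x) v * fderiv ℝ f x eN := hcg.mul (hcf eN)
  have hs2 : HasCompactSupport fun x => fderiv ℝ g (base x) v * fderiv ℝ f x eN :=
    (hs.fderiv_apply ℝ eN).mul_left
  have hint2 := hc2.integrable_of_hasCompactSupport (μ := volume) hs2
  have hzero : ∫ x in {x | height x < g (base x)},
      (fderiv ℝ f x e + fderiv ℝ g (base x) v * fderiv ℝ f x eN) = 0 := by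
    refine (setIntegral_below_graph_swap hg.continuous ((hcf e).add hc2)
      ((hs.fderiv_apply ℝ e).add hs2)).trans ?_
    refine (integral_congr_ae (Eventually.of_forall fun s => ?_)).trans (integral_zero _ _)
    have hC : ContDiff ℝ 1 fun y => f (pair y (s + g y)) :=
      hf.comp (contDiff_pair.comp (by fun_prop : ContDiff ℝ 1 fun y => (y, s + g y)))
    have hS : HasCompactSupport fun y => f (pair y (s + g y)) :=
      hasCompactSupport_slice hs (r := base) (e := fun y => pair y (s + g y))
        continuous_base (by simp)
    have h0 := integral_fderiv_eq_zero hC hS v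
    refine Eq.trans ?_ h0
    refine integral_congr_ae (Eventually.of_forall fun y => ?_)
    obtain ⟨L, hL, hLa⟩ := hasFDerivAt_pair (y, s + g y)
    have h1 := ((hf.differentiable one_ne_zero) (pair y (s + g y))).hasFDerivAt.comp
      (y, s + g y) hL
    have h2 : HasFDerivAt (fun y => (y, s + g y)) ((ContinuousLinearMap.id ℝ (Euc n)).prod
        (fderiv ℝ g y)) y :=
      (hasFDerivAt_id y).prodMk (((hg.differentiable one_ne_zero) y).hasFDerivAt.const_add s)
    have h3 := h1.comp y h2
    have h4 : fderiv ℝ (fun y => f (pair y (s + g y))) y = _ := h3.fderiv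
    simp only [h4, Pi.add_apply, ContinuousLinearMap.comp_apply, hLa, base_pair, ContinuousLinearMap.prod_apply, ContinuousLinearMap.id_apply]
    rw [pair_eq_add v, map_add, map_smul, hv, pair_single, smul_eq_mul]
  rw [integral_add hint1.integrableOn hint2.integrableOn] at hzero
  rw [eq_neg_iff_add_eq_zero, ← hzero]
  congr 1
  rw [setIntegral_below_graph hg.continuous hc2 hs2]
  refine integral_congr_ae (Eventually.of_forall fun y => ?_)
  simp only [base_pair]
  rw [integral_const_mul, heN, setIntegral_Iio_fderiv_last hf hs]

theorem gradient_apply {m : ℕ} (g : Euc m → ℝ) (y : Euc m) (i : Fin m) :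
    gradient g y i = fderiv ℝ g y (EuclideanSpace.single i 1) := by
  have h : inner ℝ (gradient g y) (EuclideanSpace.single i (1 : ℝ)) = gradient g y i := by
    rw [EuclideanSpace.inner_single_right]; simp
  rw [← h, gradient, InnerProductSpace.toDual_symm_apply]

theorem fderiv_coord {m k : ℕ} {ψ : Euc m → Euc k} {x : Euc m} (hψ : DifferentiableAt ℝ ψ x)
    (v : Euc m) (i : Fin k) : fderiv ℝ (fun x => ψ x i) x v = fderiv ℝ ψ x v i := by
  have h := ((EuclideanSpace.proj (𝕜 := ℝ) i).hasFDerivAt (x := ψ x)).comp x hψ.hasFDerivAt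
  have h' : fderiv ℝ (fun x => ψ x i) x = _ := h.fderiv
  rw [h']; rfl

/-- The vector `(-∇g, 1)` is the normal times the area element, so the right side is the flux
through the graph written over the base. -/
theorem setIntegral_below_graph_divergence {g : Euc n → ℝ} (hg : ContDiff ℝ 1 g)
    {ψ : Euc (n + 1) → Euc (n + 1)} (hψ : ContDiff ℝ 1 ψ) (hs : HasCompactSupport ψ) :
    ∫ x in {x | height x < g (base x)}, divergence ψ x
      = ∫ y, inner ℝ (ψ (pair y (g y))) (pair (-gradient g y) 1) := by
  have hC : ∀ i, ContDiff ℝ 1 fun x => ψ x i := contDiff_euclidean.1 hψ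
  have hS : ∀ i, HasCompactSupport fun x => ψ x i := fun i =>
    hs.comp_left (g := fun z : Euc (n + 1) => z i) rfl
  have hI : ∀ i v, Integrable (fun x => fderiv ℝ (fun x => ψ x i) x v) := fun i v =>
    (((hC i).continuous_fderiv one_ne_zero).clm_apply
      continuous_const).integrable_of_hasCompactSupport ((hS i).fderiv_apply ℝ v)
  have hpair : Continuous fun y : Euc n => pair y (g y) :=
    continuous_pair.comp (continuous_id.prodMk hg.continuous)
  have hSg : ∀ i, HasCompactSupport fun y => ψ (pair y (g y)) i := fun i =>
    hasCompactSupport_slice (hS i) (r := base) (e := fun y => pair y (g y))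
      continuous_base (by simp)
  have hCg : ∀ i, Continuous fun y => ψ (pair y (g y)) i := fun i => (hC i).continuous.comp hpair
  unfold divergence
  simp_rw [← fderiv_coord ((hψ.differentiable one_ne_zero) _)]
  rw [integral_finsetSum _ fun i _ => (hI i _).integrableOn, Fin.sum_univ_castSucc]
  simp_rw [setIntegral_below_graph_fderiv_castSucc hg (hC _) (hS _)]
  rw [setIntegral_below_graph_fderiv_last hg.continuous (hC _) (hS _), Finset.sum_neg_distrib,
    ← integral_finsetSum, ← integral_neg, ← integral_add]
  · refine integral_congr_ae (Eventually.of_forall fun y => ?_)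
    simp [PiLp.inner_apply, Fin.sum_univ_castSucc, gradient_apply]
  · refine Integrable.neg (integrable_finsetSum _ fun i _ => ?_)
    exact (((hg.continuous_fderiv one_ne_zero).clm_apply continuous_const).mul
      (hCg _)).integrable_of_hasCompactSupport (hSg _).mul_left
  · exact (hCg _).integrable_of_hasCompactSupport (hSg _)
  · intro i _
    exact (((hg.continuous_fderiv one_ne_zero).clm_apply continuous_const).mul
      (hCg _)).integrable_of_hasCompactSupport (hSg _).mul_left

end BelowGraph

/-! ### The relative perimeter of a subgraph -/

section Perimeter

variable {n : ℕ} {ω : Set (Euc n)} {φ : Euc n → ℝ}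

/-- The area element `√(1 + |∇φ|²)` of the graph of `φ`. -/
noncomputable def areaElement (φ : Euc n → ℝ) (y : Euc n) : ℝ :=
  Real.sqrt (1 + ‖gradient φ y‖ ^ 2)

theorem areaElement_sq (φ : Euc n → ℝ) (y : Euc n) :
    areaElement φ y ^ 2 = 1 + ‖gradient φ y‖ ^ 2 :=
  Real.sq_sqrt (by positivity)

theorem one_le_areaElement (φ : Euc n → ℝ) (y : Euc n) : 1 ≤ areaElement φ y :=
  Real.one_le_sqrt.2 (by simp)

theorem areaElement_pos (φ : Euc n → ℝ) (y : Euc n) : 0 < areaElement φ y :=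
  one_pos.trans_le (one_le_areaElement φ y)

theorem norm_pair_neg_gradient (φ : Euc n → ℝ) (y : Euc n) :
    ‖pair (-gradient φ y) 1‖ = areaElement φ y := by
  rw [areaElement, ← Real.sqrt_sq (norm_nonneg (pair _ _)), norm_pair_sq, norm_neg]
  congr 1; ring

theorem isOpen_halfCylinder (hω : IsOpen ω) : IsOpen (halfCylinder ω) :=
  (hω.preimage continuous_base).inter (isOpen_lt continuous_const continuous_height)

theorem isOpen_subgraph (hω : IsOpen ω) (hφ : ContinuousOn φ ω) : IsOpen (subgraph ω φ) := by
  have hc : ContinuousOn (fun x : Euc (n + 1) => φ (base x) - height x) (halfCylinder ω) :=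
    (hφ.comp continuous_base.continuousOn fun x hx => hx.1).sub continuous_height.continuousOn
  have h := hc.isOpen_inter_preimage (isOpen_halfCylinder hω) (isOpen_Ioi (a := (0 : ℝ)))
  convert h using 1
  ext x
  simp [subgraph]

theorem contDiffOn_gradient {k : WithTop ℕ∞} {m : WithTop ℕ∞} (hω : IsOpen ω)
    (hφ : ContDiffOn ℝ k φ ω) (hm : m + 1 ≤ k) : ContDiffOn ℝ m (gradient φ) ω :=
  (InnerProductSpace.toDual ℝ (Euc n)).symm.contDiff.comp_contDiffOn
    (hφ.fderiv_of_isOpen hω hm)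

theorem contDiffOn_areaElement {k : WithTop ℕ∞} {m : WithTop ℕ∞} (hω : IsOpen ω)
    (hφ : ContDiffOn ℝ k φ ω) (hm : m + 1 ≤ k) : ContDiffOn ℝ m (areaElement φ) ω := by
  refine ContDiffOn.sqrt (contDiffOn_const.add ((contDiffOn_gradient hω hφ hm).norm_sq ℝ)) ?_
  intro y _; positivity

theorem continuousOn_areaElement (hω : IsOpen ω) (hφ : ContDiffOn ℝ 1 φ ω) :
    ContinuousOn (areaElement φ) ω :=
  (contDiffOn_areaElement (m := 0) hω hφ (by simp)).continuousOn

/-- As `φ` is regular only on `ω`, it is replaced by the globally `C¹` function `χφ`, equal to `φ`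
near the projection of the support of `ψ`. The bottom and lateral faces contribute nothing, since
that support lies in the open half-cylinder. -/
theorem setIntegral_subgraph_divergence (hω : IsOpen ω) (hφ : ContDiffOn ℝ 1 φ ω)
    {ψ : Euc (n + 1) → Euc (n + 1)} (hψ : ContDiff ℝ 1 ψ) (hs : HasCompactSupport ψ)
    (hsub : tsupport ψ ⊆ halfCylinder ω) :
    ∫ x in subgraph ω φ, divergence ψ x
      = ∫ y in ω, inner ℝ (ψ (pair y (φ y))) (pair (-gradient φ y) 1) := by
  have hK : IsCompact (base '' tsupport ψ) := IsCompact.image hs continuous_base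
  have hKω : base '' tsupport ψ ⊆ ω := by
    rintro _ ⟨x, hx, rfl⟩; exact (hsub hx).1
  obtain ⟨χ, hχ, -, hχω, hχ1, -⟩ := exists_cutoff hK hω hKω
  have hg : ContDiff ℝ 1 fun y => χ y * φ y := by
    refine contDiff_of_tsupport_subset hω
      ((hχ.of_le (by norm_num)).contDiffOn.mul hφ) ?_
    exact (tsupport_mul_subset_left (f := χ) (g := φ)).trans hχω
  have hgφ : ∀ y ∈ base '' tsupport ψ, (fun y => χ y * φ y) =ᶠ[𝓝 y] φ := fun y hy => by
    filter_upwards [hχ1 y hy] with z hz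
    simp [hz]
  have hdiv0 : ∀ x ∉ tsupport ψ, divergence ψ x = 0 := fun x hx => by
    simp [divergence, fderiv_of_notMem_tsupport (𝕜 := ℝ) hx]
  have hmeas : MeasurableSet {x : Euc (n + 1) | height x < χ (base x) * φ (base x)} :=
    (isOpen_lt continuous_height (hg.continuous.comp continuous_base)).measurableSet
  calc ∫ x in subgraph ω φ, divergence ψ x
      = ∫ x in {x | height x < χ (base x) * φ (base x)}, divergence ψ x := by
        rw [← integral_indicator (isOpen_subgraph hω hφ.continuousOn).measurableSet,
          ← integral_indicator hmeas]
        refine integral_congr_ae (Eventually.of_forall fun x => ?_)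
        by_cases hx : x ∈ tsupport ψ
        · have h1 := hsub hx
          have h2 : χ (base x) * φ (base x) = φ (base x) :=
            (hgφ (base x) ⟨x, hx, rfl⟩).eq_of_nhds
          simp [indicator, subgraph, h1, h2]
        · simp [indicator, hdiv0 x hx]
    _ = ∫ y, inner ℝ (ψ (pair y (χ y * φ y)))
          (pair (-gradient (fun y => χ y * φ y) y) 1) :=
        setIntegral_below_graph_divergence hg hψ hs
    _ = ∫ y in ω, inner ℝ (ψ (pair y (φ y))) (pair (-gradient φ y) 1) := by
        rw [← integral_indicator hω.measurableSet]
        refine integral_congr_ae (Eventually.of_forall fun y => ?_)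
        by_cases hy : y ∈ base '' tsupport ψ
        · have h2 := (hgφ y hy).eq_of_nhds
          have h3 : gradient (fun y => χ y * φ y) y = gradient φ y := by
            simp only [gradient, (hgφ y hy).fderiv_eq]
          simp only [indicator, hKω hy, if_true, h2, h3]
        · have h0 : ∀ t, ψ (pair y t) = 0 := fun t =>
            image_eq_zero_of_notMem_tsupport fun h => hy ⟨_, h, by simp⟩
          simp [indicator, h0]

theorem relPerimeter_subgraph_le (hω : IsOpen ω) (hφ : ContDiffOn ℝ 1 φ ω) :
    relPerimeter (halfCylinder ω) (subgraph ω φ)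
      ≤ ∫⁻ y in ω, ENNReal.ofReal (areaElement φ y) := by
  refine iSup₂_le fun ψ hψ => ?_
  rw [setIntegral_subgraph_divergence hω hφ hψ.contDiff hψ.hasCompactSupport hψ.tsupport_subset]
  refine (Real.ofReal_le_enorm _).trans ((enorm_integral_le_lintegral_enorm _).trans ?_)
  refine lintegral_mono fun y => ?_
  rw [← ofReal_norm]
  refine ENNReal.ofReal_le_ofReal ((norm_inner_le_norm _ _).trans ?_)
  rw [norm_pair_neg_gradient]
  exact mul_le_of_le_one_left (areaElement_pos φ y).le (hψ.norm_le_one _)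

/-- The test field is the unit normal, extended constantly in the vertical direction and cut off to
be exact on the graph over `K`. It is `C¹` because `φ` is `C²`. -/
theorem setLIntegral_areaElement_le_relPerimeter (hω : IsOpen ω) (hφ : ContDiffOn ℝ 2 φ ω)
    (hpos : ∀ y ∈ ω, 0 < φ y) {K : Set (Euc n)} (hK : IsCompact K) (hKω : K ⊆ ω) :
    ∫⁻ y in K, ENNReal.ofReal (areaElement φ y)
      ≤ relPerimeter (halfCylinder ω) (subgraph ω φ) := by
  have hφ1 : ContDiffOn ℝ 1 φ ω := hφ.of_le (by norm_num)
  have hgraph : ContinuousOn (fun y => pair y (φ y)) ω :=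
    continuous_pair.comp_continuousOn (continuousOn_id.prodMk hφ.continuousOn)
  obtain ⟨χ, hχ, hχs, hχsub, hχ1, hχI⟩ := exists_cutoff
    (hK.image_of_continuousOn (hgraph.mono hKω)) (isOpen_halfCylinder hω) (by
      rintro _ ⟨y, hy, rfl⟩
      exact ⟨by simpa using hKω hy, by simpa using hpos y (hKω hy)⟩)
  have hnormal : ContDiffOn ℝ 1
      (fun y => (areaElement φ y)⁻¹ • pair (-gradient φ y) 1) ω := by
    refine ((contDiffOn_areaElement hω hφ (by norm_num)).inv
      fun y _ => (areaElement_pos φ y).ne').smul ?_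
    exact contDiff_pair.comp_contDiffOn
      ((contDiffOn_gradient hω hφ (by norm_num)).neg.prodMk contDiffOn_const)
  let ψ : Euc (n + 1) → Euc (n + 1) := fun x =>
    χ x • ((areaElement φ (base x))⁻¹ • pair (-gradient φ (base x)) 1)
  have hψsupp : tsupport ψ ⊆ tsupport χ := tsupport_smul_subset_left χ _
  have hψ : IsTestField (halfCylinder ω) ψ :=
    { contDiff := by
        refine contDiff_of_tsupport_subset (isOpen_halfCylinder hω) ?_ (hψsupp.trans hχsub)
        exact (hχ.of_le (by norm_num)).contDiffOn.smul
          (hnormal.comp contDiff_base.contDiffOn fun x hx => hx.1)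
      hasCompactSupport := hχs.smul_right
      tsupport_subset := hψsupp.trans hχsub
      norm_le_one := fun x => by
        have h := areaElement_pos φ (base x)
        simp only [ψ, norm_smul, norm_pair_neg_gradient, norm_inv, Real.norm_of_nonneg h.le,
          Real.norm_of_nonneg (hχI x).1, inv_mul_cancel₀ h.ne', mul_one]
        exact (hχI x).2 }
  have hval : ∀ y, inner ℝ (ψ (pair y (φ y))) (pair (-gradient φ y) 1)
      = χ (pair y (φ y)) * areaElement φ y := fun y => by
    have h := areaElement_pos φ y
    simp only [ψ, base_pair, real_inner_smul_left, real_inner_self_eq_norm_sq,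
      norm_pair_neg_gradient]
    field_simp
  have hcont : ContinuousOn (fun y => χ (pair y (φ y)) * areaElement φ y) ω :=
    (hχ.continuous.comp_continuousOn hgraph).mul (continuousOn_areaElement hω hφ1)
  have hint : IntegrableOn (fun y => χ (pair y (φ y)) * areaElement φ y) ω := by
    have hc : IsCompact (base '' tsupport χ) := IsCompact.image hχs continuous_base
    have hsub : base '' tsupport χ ⊆ ω := by
      rintro _ ⟨x, hx, rfl⟩; exact (hχsub hx).1
    -- The area element is not known to be integrable on `ω`; the cutoff confines the integrand to a
    -- compact subset.
    refine ((hcont.mono hsub).integrableOn_compact hc).of_forall_sdiff_eq_zero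
      hω.measurableSet fun y hy => ?_
    rw [image_eq_zero_of_notMem_tsupport fun h => hy.2 ⟨_, h, by simp⟩, zero_mul]
  refine le_trans ?_ (le_iSup₂ (f := fun (ψ : Euc (n + 1) → Euc (n + 1))
    (_ : IsTestField (halfCylinder ω) ψ) =>
      ENNReal.ofReal (∫ x in subgraph ω φ, divergence ψ x)) ψ hψ)
  rw [setIntegral_subgraph_divergence hω hφ1 hψ.contDiff hψ.hasCompactSupport
    hψ.tsupport_subset]
  simp_rw [hval]
  rw [ofReal_integral_eq_lintegral_ofReal hint (Eventually.of_forall fun y =>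
    mul_nonneg (hχI _).1 (areaElement_pos φ y).le)]
  refine le_trans ?_ (lintegral_mono_set hKω)
  refine setLIntegral_mono' hK.measurableSet fun y hy => ?_
  rw [(hχ1 _ ⟨y, hy, rfl⟩).eq_of_nhds, one_mul]

theorem relPerimeter_subgraph (hω : IsOpen ω) (hb : Bornology.IsBounded ω)
    (hφ : ContDiffOn ℝ 2 φ ω) (hpos : ∀ y ∈ ω, 0 < φ y) :
    relPerimeter (halfCylinder ω) (subgraph ω φ)
      = ∫⁻ y in ω, ENNReal.ofReal (areaElement φ y) := by
  refine le_antisymm (relPerimeter_subgraph_le hω (hφ.of_le (by norm_num))) ?_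
  -- Exhaustion of `ω` by compact sets turns the local lower bounds into the full one by monotone
  -- convergence.
  obtain ⟨F, hFc, hFω, hF, hmono⟩ := hω.exists_iUnion_isClosed
  rw [← hF, setLIntegral_iUnion_of_directed _ hmono.directed_le, hF]
  refine iSup_le fun k => setLIntegral_areaElement_le_relPerimeter hω hφ hpos ?_ (hFω k)
  exact Metric.isCompact_of_isClosed_isBounded (hFc k) (hb.subset (hFω k))

theorem volume_subgraph (hω : IsOpen ω) (hφ : ContinuousOn φ ω) :
    volume (subgraph ω φ) = ∫⁻ y in ω, ENNReal.ofReal (φ y) := by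
  have hm : MeasurableSet (subgraph ω φ) := (isOpen_subgraph hω hφ).measurableSet
  rw [← (measurePreserving_pairEquiv n).measure_preimage hm.nullMeasurableSet,
    Measure.volume_eq_prod, Measure.prod_apply ((pairEquiv n).measurable hm),
    ← lintegral_indicator hω.measurableSet]
  refine lintegral_congr fun y => ?_
  by_cases hy : y ∈ ω
  · have : Prod.mk y ⁻¹' (pairEquiv n ⁻¹' subgraph ω φ) = Ioo 0 (φ y) := by
      ext t; simp [pairEquiv, subgraph, halfCylinder, hy]
    rw [this]; simp [hy]
  · have : Prod.mk y ⁻¹' (pairEquiv n ⁻¹' subgraph ω φ) = ∅ := by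
      ext t; simp [pairEquiv, subgraph, halfCylinder, hy]
    rw [this]; simp [hy]

end Perimeter

/-! ### Mean curvature of a graph -/

section Curvature

variable {n : ℕ} {ω : Set (Euc n)} {φ : Euc n → ℝ}

/-- The horizontal part `-∇φ / √(1 + |∇φ|²)` of the unit normal of the graph of `φ`. -/
noncomputable def horizontalNormal (φ : Euc n → ℝ) (y : Euc n) : Euc n :=
  (areaElement φ y)⁻¹ • (-gradient φ y)

theorem contDiffOn_horizontalNormal (hω : IsOpen ω) (hφ : ContDiffOn ℝ 2 φ ω) :
    ContDiffOn ℝ 1 (horizontalNormal φ) ω :=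
  ((contDiffOn_areaElement hω hφ (by norm_num)).inv
    fun y _ => (areaElement_pos φ y).ne').smul (contDiffOn_gradient hω hφ (by norm_num)).neg

theorem graphNormal_eq (hω : IsOpen ω) {x : Euc (n + 1)} (hx : base x ∈ ω) :
    graphNormal ω φ x
      = pair (horizontalNormal φ (base x)) (areaElement φ (base x))⁻¹ := by
  have h : gradientWithin φ (closure ω) (base x) = gradient φ (base x) := by
    rw [gradientWithin, gradient,
      fderivWithin_of_mem_nhds (mem_of_superset (hω.mem_nhds hx) subset_closure)]
  rw [graphNormal, h]
  ext i
  refine Fin.lastCases ?_ (fun j => ?_) i <;> simp [horizontalNormal, areaElement]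

/-- Valid at every point, whatever value `gradientWithin` takes there, so that the constant norm can
be differentiated. -/
theorem norm_graphNormal (ω : Set (Euc n)) (φ : Euc n → ℝ) (x : Euc (n + 1)) :
    ‖graphNormal ω φ x‖ = 1 := by
  have hpos : 0 < Real.sqrt (1 + ‖gradientWithin φ (closure ω) (base x)‖ ^ 2) := by positivity
  have h : ‖pair (-gradientWithin φ (closure ω) (base x)) 1‖
      = Real.sqrt (1 + ‖gradientWithin φ (closure ω) (base x)‖ ^ 2) := by
    rw [← Real.sqrt_sq (norm_nonneg (pair _ _)), norm_pair_sq, norm_neg]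
    congr 1; ring
  rw [graphNormal, norm_smul, h, norm_inv, Real.norm_of_nonneg hpos.le, inv_mul_cancel₀ hpos.ne']

theorem inner_fderiv_eq_zero_of_norm_eq_one {m : ℕ} {ν : Euc m → Euc m} {x : Euc m}
    (hν : DifferentiableAt ℝ ν x) (h1 : ∀ z, ‖ν z‖ = 1) (v : Euc m) :
    inner ℝ (fderiv ℝ ν x v) (ν x) = 0 := by
  have h := fderiv_inner_apply ℝ hν hν v
  have hc : (fun z => inner ℝ (ν z) (ν z)) = fun _ => (1 : ℝ) := by
    ext z; rw [real_inner_self_eq_norm_sq, h1, one_pow]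
  rw [hc, real_inner_comm] at h
  simp only [fderiv_fun_const, Pi.zero_apply, zero_apply] at h
  linarith

/-- The derivative of a unit field is orthogonal to the field, so the normal correction in
`meanCurvature` vanishes. The vertical term of the divergence vanishes because the normal does not
depend on height. -/
theorem meanCurvature_graphNormal (hn : 1 ≤ n) (hω : IsOpen ω) (hφ : ContDiffOn ℝ 2 φ ω)
    {x : Euc (n + 1)} (hx : base x ∈ ω) :
    n * meanCurvature (graphNormal ω φ) x = divergence (horizontalNormal φ) (base x) := by
  set N : Euc n → Euc (n + 1) := fun y => pair (horizontalNormal φ y) (areaElement φ y)⁻¹ with hN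
  have hNd : DifferentiableAt ℝ N (base x) := by
    have h : ContDiffOn ℝ 1 N ω := contDiff_pair.comp_contDiffOn
      ((contDiffOn_horizontalNormal hω hφ).prodMk
        ((contDiffOn_areaElement hω hφ (by norm_num)).inv fun y _ => (areaElement_pos φ y).ne'))
    exact (h.contDiffAt (hω.mem_nhds hx)).differentiableAt one_ne_zero
  have heq : graphNormal ω φ =ᶠ[𝓝 x] N ∘ base := by
    filter_upwards [(hω.preimage continuous_base).mem_nhds hx] with z hz
    exact graphNormal_eq hω hz
  obtain ⟨L, hL, hLa⟩ := hasFDerivAt_base x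
  have hd : HasFDerivAt (graphNormal ω φ) ((fderiv ℝ N (base x)).comp L) x :=
    (hNd.hasFDerivAt.comp x hL).congr_of_eventuallyEq heq
  have hVd : DifferentiableAt ℝ (horizontalNormal φ) (base x) :=
    ((contDiffOn_horizontalNormal hω hφ).contDiffAt (hω.mem_nhds hx)).differentiableAt one_ne_zero
  have hn0 : (n : ℝ) ≠ 0 := by exact_mod_cast (by omega : n ≠ 0)
  rw [meanCurvature, inner_fderiv_eq_zero_of_norm_eq_one hd.differentiableAt
    (norm_graphNormal ω φ), sub_zero, mul_div_cancel₀ _ hn0, divergence, divergence,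
    Fin.sum_univ_castSucc]
  have hlast : base (EuclideanSpace.single (Fin.last n) (1 : ℝ)) = (0 : Euc n) := by
    ext i; simp [base]
  have hcast : ∀ i : Fin n, base (EuclideanSpace.single i.castSucc (1 : ℝ))
      = (EuclideanSpace.single i 1 : Euc n) := fun i => by
    rw [← pair_single, base_pair]
  simp only [hd.fderiv, ContinuousLinearMap.comp_apply, hLa, hlast, hcast, map_zero]
  simp only [PiLp.zero_apply, add_zero]
  refine Finset.sum_congr rfl fun i _ => ?_
  rw [← fderiv_coord hNd, ← fderiv_coord hVd]
  simp [hN]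

theorem continuousOn_divergence {m : ℕ} {U : Set (Euc m)} (hU : IsOpen U) {V : Euc m → Euc m}
    (hV : ContDiffOn ℝ 1 V U) : ContinuousOn (divergence V) U := by
  refine continuousOn_finsetSum _ fun i _ => ?_
  have h := (hV.continuousOn_fderiv_of_isOpen hU le_rfl).clm_apply
    (continuousOn_const (c := EuclideanSpace.single i (1 : ℝ)))
  exact (EuclideanSpace.proj (𝕜 := ℝ) i).continuous.comp_continuousOn h

theorem integral_divergence_eq_zero {m : ℕ} {W : Euc m → Euc m} (hW : ContDiff ℝ 1 W)
    (hs : HasCompactSupport W) : ∫ y, divergence W y = 0 := by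
  have hC : ∀ i, ContDiff ℝ 1 fun x => W x i := contDiff_euclidean.1 hW
  have hS : ∀ i, HasCompactSupport fun x => W x i := fun i =>
    hs.comp_left (g := fun z : Euc m => z i) rfl
  unfold divergence
  simp_rw [← fderiv_coord ((hW.differentiable one_ne_zero) _)]
  rw [integral_finsetSum]
  · simp_rw [integral_fderiv_eq_zero (hC _) (hS _)]; simp
  · exact fun i _ => (((hC i).continuous_fderiv one_ne_zero).clm_apply
      continuous_const).integrable_of_hasCompactSupport ((hS i).fderiv_apply ℝ _)

theorem divergence_smul {m : ℕ} {η : Euc m → ℝ} {V : Euc m → Euc m} {y : Euc m}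
    (hη : DifferentiableAt ℝ η y) (hV : DifferentiableAt ℝ V y) :
    divergence (fun y => η y • V y) y = η y * divergence V y + inner ℝ (V y) (gradient η y) := by
  rw [PiLp.inner_apply]
  simp [divergence, fderiv_fun_smul hη hV, Finset.sum_add_distrib, Finset.mul_sum,
    gradient_apply]

theorem setIntegral_divergence_smul {m : ℕ} {U : Set (Euc m)} (hU : IsOpen U)
    {V : Euc m → Euc m} (hV : ContDiffOn ℝ 1 V U) {η : Euc m → ℝ} (hη : ContDiff ℝ 1 η)
    (hs : HasCompactSupport η) (hsub : tsupport η ⊆ U) :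
    ∫ y in U, (η y * divergence V y + inner ℝ (V y) (gradient η y)) = 0 := by
  have hsupp : tsupport (fun y => η y • V y) ⊆ tsupport η := tsupport_smul_subset_left η V
  have hW : ContDiff ℝ 1 fun y => η y • V y :=
    contDiff_of_tsupport_subset hU (hη.contDiffOn.smul hV) (hsupp.trans hsub)
  rw [← integral_divergence_eq_zero hW hs.smul_right, ← integral_indicator hU.measurableSet]
  refine integral_congr_ae (Eventually.of_forall fun y => ?_)
  by_cases hy : y ∈ U
  · simp only [indicator, hy, if_true]
    exact (divergence_smul (hη.differentiable one_ne_zero y)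
      ((hV.contDiffAt (hU.mem_nhds hy)).differentiableAt one_ne_zero)).symm
  · have : y ∉ tsupport fun y => η y • V y := fun h => hy (hsub (hsupp h))
    simp [indicator, hy, divergence, fderiv_of_notMem_tsupport (𝕜 := ℝ) this]

/-- The tangent line bound `√(A² + δ) ≤ A + δ / (2A)`, with the quadratic remainder enlarged using
`A ≥ 1`. It holds for every `ε`, so it can be integrated without any limit theorem. -/
theorem areaElement_sub_le {η : Euc n → ℝ} {y : Euc n} (hφ : DifferentiableAt ℝ φ y)
    (hη : DifferentiableAt ℝ η y) (ε : ℝ) :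
    areaElement (fun y => φ y - ε * η y) y ≤ areaElement φ y
      + ε * inner ℝ (horizontalNormal φ y) (gradient η y) + ε ^ 2 * ‖gradient η y‖ ^ 2 := by
  have hg : gradient (fun y => φ y - ε * η y) y = gradient φ y - ε • gradient η y := by
    simp [gradient, fderiv_fun_sub hφ (hη.const_mul ε), fderiv_const_mul hη]
  set A := areaElement φ y with hA
  have hA1 : 1 ≤ A := one_le_areaElement φ y
  have hA2 : A ^ 2 = 1 + ‖gradient φ y‖ ^ 2 := areaElement_sq φ y
  set p := gradient φ y
  set q := gradient η y
  have hin : inner ℝ (horizontalNormal φ y) q = -(A⁻¹ * inner ℝ p q) := by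
    simp only [horizontalNormal, real_inner_smul_left, inner_neg_left, mul_neg]
    rfl
  set r := inner ℝ p q
  have hX : 1 + ‖p - ε • q‖ ^ 2 = A ^ 2 - 2 * ε * r + ε ^ 2 * ‖q‖ ^ 2 := by
    rw [norm_sub_sq_real, real_inner_smul_right, norm_smul, Real.norm_eq_abs, mul_pow, sq_abs, hA2]
    ring
  have hX0 : 0 ≤ A ^ 2 - 2 * ε * r + ε ^ 2 * ‖q‖ ^ 2 := hX ▸ by positivity
  have hs : A * (A⁻¹ * r) = r := mul_inv_cancel_left₀ (by positivity) r
  have hm : A * (A⁻¹ * (ε ^ 2 * ‖q‖ ^ 2 / 2)) = ε ^ 2 * ‖q‖ ^ 2 / 2 :=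
    mul_inv_cancel_left₀ (by positivity) _
  have hm0 : 0 ≤ A⁻¹ * (ε ^ 2 * ‖q‖ ^ 2 / 2) := by positivity
  rw [areaElement, hg, hin, hX]
  set s := A⁻¹ * r
  set m := A⁻¹ * (ε ^ 2 * ‖q‖ ^ 2 / 2)
  have hX' : A ^ 2 - 2 * ε * r + ε ^ 2 * ‖q‖ ^ 2 = A ^ 2 - 2 * ε * (A * s) + 2 * (A * m) := by
    rw [hs, hm]; ring
  rw [hX'] at hX0 ⊢
  clear_value s m A
  have hsqrt : Real.sqrt (A ^ 2 - 2 * ε * (A * s) + 2 * (A * m)) ≤ A - ε * s + m := by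
    refine Real.sqrt_le_iff.2 ⟨?_, ?_⟩
    -- Twice this product is `A²` plus the radicand.
    · have h2 : 0 ≤ A * (A - ε * s + m) := by nlinarith [sq_nonneg A]
      exact nonneg_of_mul_nonneg_right h2 (by positivity)
    -- The square of the right side exceeds the radicand by exactly `(m - εs)²`.
    · nlinarith [sq_nonneg (m - ε * s)]
  nlinarith [mul_le_mul_of_nonneg_right hA1 hm0]

end Curvature

/-! ### First variation of the Cheeger quotient -/

section Variation

variable {n : ℕ} {ω : Set (Euc n)} {φ : Euc n → ℝ}

theorem IsSelfCheeger.le_div {C Ω E : Set (Euc n)} (h : IsSelfCheeger C Ω)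
    (hE : IsCompetitor Ω E) : relPerimeter C Ω / volume Ω ≤ relPerimeter C E / volume E :=
  h.2.le.trans (iInf₂_le E hE)

theorem nonempty_subgraph (hne : ω.Nonempty) (hpos : ∀ y ∈ ω, 0 < φ y) :
    (subgraph ω φ).Nonempty := by
  obtain ⟨y, hy⟩ := hne
  have := hpos y hy
  exact ⟨pair y (φ y / 2), ⟨by simpa using hy, by simpa using this⟩, by simpa using this⟩

theorem isCompetitor_subgraph {θ : Euc n → ℝ} (hω : IsOpen ω) (hne : ω.Nonempty)
    (hθ : ContinuousOn θ ω) (hθpos : ∀ y ∈ ω, 0 < θ y) (hθφ : ∀ y ∈ ω, θ y ≤ φ y)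
    (hfin : volume (subgraph ω φ) ≠ ∞) : IsCompetitor (subgraph ω φ) (subgraph ω θ) := by
  have hsub : subgraph ω θ ⊆ subgraph ω φ :=
    fun x hx => ⟨hx.1, hx.2.trans_le (hθφ _ hx.1.1)⟩
  have hopen := isOpen_subgraph hω hθ
  exact ⟨hopen.measurableSet, hsub,
    (hopen.measure_pos volume (nonempty_subgraph hne hθpos)).ne',
    ne_top_of_le_ne_top hfin (measure_mono hsub)⟩

/-- The flat subgraph of height `c` is a competitor of perimeter at most `|ω|`, so the minimal
quotient is finite. -/
theorem relPerimeter_subgraph_ne_top (hω : IsOpen ω) (hne : ω.Nonempty)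
    (hb : Bornology.IsBounded ω) {c : ℝ} (hc : 0 < c) (hcφ : ∀ y ∈ ω, c ≤ φ y)
    (hself : IsSelfCheeger (halfCylinder ω) (subgraph ω φ)) :
    relPerimeter (halfCylinder ω) (subgraph ω φ) ≠ ∞ := by
  have hE : IsCompetitor (subgraph ω φ) (subgraph ω fun _ => c) :=
    isCompetitor_subgraph hω hne continuousOn_const (fun _ _ => hc) hcφ hself.1.volume_ne_top
  have hP : relPerimeter (halfCylinder ω) (subgraph ω fun _ => c) ≠ ∞ := by
    refine ne_top_of_le_ne_top ?_ (relPerimeter_subgraph_le hω contDiffOn_const)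
    simpa [areaElement, gradient] using hb.measure_lt_top.ne
  intro htop
  have h := hself.le_div hE
  rw [htop, ENNReal.top_div_of_ne_top hself.1.volume_ne_top] at h
  exact ENNReal.div_ne_top hP hE.volume_ne_zero (top_le_iff.1 h)

theorem integrableOn_of_setLIntegral_ne_top {m : ℕ} {U : Set (Euc m)} (hU : IsOpen U)
    {f : Euc m → ℝ} (hf : ContinuousOn f U) (h0 : ∀ y ∈ U, 0 ≤ f y)
    (h : ∫⁻ y in U, ENNReal.ofReal (f y) ≠ ∞) : IntegrableOn f U :=
  (lintegral_ofReal_ne_top_iff_integrable (hf.aestronglyMeasurable hU.measurableSet)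
    ((ae_restrict_iff' hU.measurableSet).2 (Eventually.of_forall h0))).1 h

theorem norm_horizontalNormal_le_one (φ : Euc n → ℝ) (y : Euc n) : ‖horizontalNormal φ y‖ ≤ 1 := by
  have hA := areaElement_pos φ y
  rw [horizontalNormal, norm_smul, norm_inv, norm_neg, Real.norm_of_nonneg hA.le,
    inv_mul_le_one₀ hA]
  exact Real.le_sqrt_of_sq_le (by linarith)

theorem continuous_gradient {η : Euc n → ℝ} (hη : ContDiff ℝ 1 η) : Continuous (gradient η) :=
  continuousOn_univ.1 (contDiffOn_gradient (m := 0) isOpen_univ hη.contDiffOn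
    (by simp)).continuousOn

theorem hasCompactSupport_gradient {η : Euc n → ℝ} (hs : HasCompactSupport η) :
    HasCompactSupport (gradient η) :=
  (hs.fderiv ℝ).comp_left (map_zero (InnerProductSpace.toDual ℝ (Euc n)).symm)

theorem integrableOn_inner_horizontalNormal (hω : IsOpen ω) (hφ : ContDiffOn ℝ 2 φ ω)
    {η : Euc n → ℝ} (hη : ContDiff ℝ 1 η) (hs : HasCompactSupport η) :
    IntegrableOn (fun y => inner ℝ (horizontalNormal φ y) (gradient η y)) ω := by
  have hgrad := continuous_gradient hη
  have hgi : IntegrableOn (fun y => ‖gradient η y‖) ω :=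
    (hgrad.norm.integrable_of_hasCompactSupport (hasCompactSupport_gradient hs).norm).integrableOn
  refine hgi.mono' (((contDiffOn_horizontalNormal hω hφ).continuousOn.inner
    hgrad.continuousOn).aestronglyMeasurable hω.measurableSet)
    (Eventually.of_forall fun y => (norm_inner_le_norm _ _).trans ?_)
  exact mul_le_of_le_one_left (norm_nonneg _) (norm_horizontalNormal_le_one φ y)

theorem integrableOn_norm_gradient_sq (ω : Set (Euc n)) {η : Euc n → ℝ} (hη : ContDiff ℝ 1 η)
    (hs : HasCompactSupport η) : IntegrableOn (fun y => ‖gradient η y‖ ^ 2) ω := by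
  have hc : Continuous fun y => ‖gradient η y‖ ^ 2 := (continuous_gradient hη).norm.pow 2
  have hsupp : HasCompactSupport fun y => ‖gradient η y‖ ^ 2 :=
    (hasCompactSupport_gradient hs).comp_left (g := fun v : Euc n => ‖v‖ ^ 2) (by simp)
  exact (hc.integrable_of_hasCompactSupport hsupp).integrableOn

theorem relPerimeter_subgraph_sub_le (hω : IsOpen ω) (hφ : ContDiffOn ℝ 2 φ ω)
    (hA : IntegrableOn (areaElement φ) ω) {η : Euc n → ℝ} (hη : ContDiff ℝ 1 η)
    (hs : HasCompactSupport η) (ε : ℝ) :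
    ∃ R, 0 ≤ R ∧ relPerimeter (halfCylinder ω) (subgraph ω fun y => φ y - ε * η y)
        ≤ ENNReal.ofReal R ∧
      R = (∫ y in ω, areaElement φ y)
        + ε * (∫ y in ω, inner ℝ (horizontalNormal φ y) (gradient η y))
        + ε ^ 2 * ∫ y in ω, ‖gradient η y‖ ^ 2 := by
  have hφ1 : ContDiffOn ℝ 1 φ ω := hφ.of_le (by norm_num)
  have hV := (integrableOn_inner_horizontalNormal hω hφ hη hs).const_mul ε
  have hS := (integrableOn_norm_gradient_sq ω hη hs).const_mul (ε ^ 2)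
  have hAV : IntegrableOn (fun y => areaElement φ y
      + ε * inner ℝ (horizontalNormal φ y) (gradient η y)) ω := hA.add hV
  have hAVS : IntegrableOn (fun y => areaElement φ y
      + ε * inner ℝ (horizontalNormal φ y) (gradient η y)
      + ε ^ 2 * ‖gradient η y‖ ^ 2) ω := hAV.add hS
  have hpt : ∀ y ∈ ω, areaElement (fun y => φ y - ε * η y) y ≤ areaElement φ y
      + ε * inner ℝ (horizontalNormal φ y) (gradient η y) + ε ^ 2 * ‖gradient η y‖ ^ 2 :=
    fun y hy => areaElement_sub_le
      ((hφ1.contDiffAt (hω.mem_nhds hy)).differentiableAt one_ne_zero)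
      (hη.differentiable one_ne_zero y) ε
  have h0 : ∀ y ∈ ω, 0 ≤ areaElement φ y
      + ε * inner ℝ (horizontalNormal φ y) (gradient η y) + ε ^ 2 * ‖gradient η y‖ ^ 2 :=
    fun y hy => (areaElement_pos _ y).le.trans (hpt y hy)
  refine ⟨∫ y in ω, (areaElement φ y
      + ε * inner ℝ (horizontalNormal φ y) (gradient η y) + ε ^ 2 * ‖gradient η y‖ ^ 2),
    setIntegral_nonneg hω.measurableSet h0, ?_, ?_⟩
  · refine (relPerimeter_subgraph_le hω
      (hφ1.sub (contDiffOn_const.mul hη.contDiffOn))).trans ?_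
    rw [ofReal_integral_eq_lintegral_ofReal hAVS
      ((ae_restrict_iff' hω.measurableSet).2 (Eventually.of_forall h0))]
    exact setLIntegral_mono' hω.measurableSet fun y hy => ENNReal.ofReal_le_ofReal (hpt y hy)
  · rw [integral_add hAV hS, integral_add hA hV, integral_const_mul, integral_const_mul]

theorem volume_subgraph_eq_ofReal {θ : Euc n → ℝ} (hω : IsOpen ω) (hθ : ContinuousOn θ ω)
    (hθ0 : ∀ y ∈ ω, 0 ≤ θ y) (hint : IntegrableOn θ ω) :
    volume (subgraph ω θ) = ENNReal.ofReal (∫ y in ω, θ y) := by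
  rw [volume_subgraph hω hθ, ofReal_integral_eq_lintegral_ofReal hint
    ((ae_restrict_iff' hω.measurableSet).2 (Eventually.of_forall hθ0))]

/-- The zeroth-order terms cancel; dividing by `ε > 0` leaves an error `εS` that vanishes in the
limit. -/
theorem neg_le_of_forall_quotient_le {P M Q S I c : ℝ} (hM : 0 < M) (hc : 0 < c)
    (h : ∀ ε ∈ Ioo 0 c, P / M * (M - ε * I) ≤ P + ε * Q + ε ^ 2 * S) : -Q ≤ P / M * I := by
  have key : ∀ ε ∈ Ioo 0 c, -Q ≤ P / M * I + ε * S := by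
    intro ε hε
    have hPM : P / M * (M - ε * I) = P - ε * (P / M * I) := by
      rw [mul_sub, div_mul_cancel₀ P hM.ne']; ring
    have h1 : 0 ≤ ε * (P / M * I + ε * S + Q) := by
      have := h ε hε
      rw [hPM] at this
      linarith
    linarith [nonneg_of_mul_nonneg_right h1 hε.1]
  have htend : Tendsto (fun ε : ℝ => P / M * I + ε * S) (𝓝[>] 0) (𝓝 (P / M * I)) := by
    have h : Tendsto (fun ε : ℝ => P / M * I + ε * S) (𝓝 0) (𝓝 (P / M * I + 0 * S)) :=
      (by fun_prop : Continuous fun ε : ℝ => P / M * I + ε * S).tendsto 0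
    rw [zero_mul, add_zero] at h
    exact h.mono_left nhdsWithin_le_nhds
  refine ge_of_tendsto htend ?_
  filter_upwards [Ioo_mem_nhdsGT hc] with ε hε using key ε hε

theorem first_variation_le (hω : IsOpen ω) (hne : ω.Nonempty) (hb : Bornology.IsBounded ω)
    (hφ : ContDiffOn ℝ 2 φ ω) {c : ℝ} (hc : 0 < c) (hcφ : ∀ y ∈ ω, c ≤ φ y)
    (hself : IsSelfCheeger (halfCylinder ω) (subgraph ω φ))
    {η : Euc n → ℝ} (hη : ContDiff ℝ 1 η) (hs : HasCompactSupport η)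
    (hη0 : ∀ y, 0 ≤ η y) (hη1 : ∀ y, η y ≤ 1) :
    -∫ y in ω, inner ℝ (horizontalNormal φ y) (gradient η y)
      ≤ (relPerimeter (halfCylinder ω) (subgraph ω φ)).toReal / (volume (subgraph ω φ)).toReal
        * ∫ y in ω, η y := by
  have hφ1 : ContDiffOn ℝ 1 φ ω := hφ.of_le (by norm_num)
  have hpos : ∀ y ∈ ω, 0 < φ y := fun y hy => hc.trans_le (hcφ y hy)
  have hP := relPerimeter_subgraph hω hb hφ hpos
  have hPtop := relPerimeter_subgraph_ne_top hω hne hb hc hcφ hself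
  have hMtop := hself.1.volume_ne_top
  have hAint : IntegrableOn (areaElement φ) ω :=
    integrableOn_of_setLIntegral_ne_top hω (continuousOn_areaElement hω hφ1)
      (fun y _ => (areaElement_pos φ y).le) (hP ▸ hPtop)
  have hφint : IntegrableOn φ ω :=
    integrableOn_of_setLIntegral_ne_top hω hφ.continuousOn (fun y hy => (hpos y hy).le)
      (volume_subgraph hω hφ.continuousOn ▸ hMtop)
  have hηint : IntegrableOn η ω := (hη.continuous.integrable_of_hasCompactSupport hs).integrableOn
  have hPof : relPerimeter (halfCylinder ω) (subgraph ω φ)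
      = ENNReal.ofReal (∫ y in ω, areaElement φ y) := by
    rw [hP, ofReal_integral_eq_lintegral_ofReal hAint
      (Eventually.of_forall fun y => (areaElement_pos φ y).le)]
  have hMof := volume_subgraph_eq_ofReal hω hφ.continuousOn (fun y hy => (hpos y hy).le) hφint
  have hMpos : 0 < ∫ y in ω, φ y :=
    ENNReal.ofReal_pos.1 (hMof ▸ pos_iff_ne_zero.2 hself.1.volume_ne_zero)
  have hP0 : 0 ≤ ∫ y in ω, areaElement φ y := integral_nonneg fun y => (areaElement_pos φ y).le
  rw [hPof, hMof, ENNReal.toReal_ofReal hP0, ENNReal.toReal_ofReal hMpos.le]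
  refine neg_le_of_forall_quotient_le (S := ∫ y in ω, ‖gradient η y‖ ^ 2) hMpos hc ?_
  rintro ε ⟨hε, hεc⟩
  have hθC : ContinuousOn (fun y => φ y - ε * η y) ω :=
    hφ.continuousOn.sub (continuousOn_const.mul hη.continuous.continuousOn)
  -- Here `ε < c ≤ φ` and `η ≤ 1` keep the lowered graph above height zero.
  have hθpos : ∀ y ∈ ω, 0 < φ y - ε * η y := fun y hy => by
    linarith [mul_le_mul_of_nonneg_left (hη1 y) hε.le, hcφ y hy]
  have hE := isCompetitor_subgraph hω hne hθC hθpos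
    (fun y _ => sub_le_self _ (mul_nonneg hε.le (hη0 y))) hMtop
  have hEvol := volume_subgraph_eq_ofReal hω hθC (fun y hy => (hθpos y hy).le)
    (hφint.sub (hηint.const_mul ε))
  rw [integral_sub hφint (hηint.const_mul ε), integral_const_mul] at hEvol
  have hEpos := ENNReal.ofReal_pos.1 (hEvol ▸ pos_iff_ne_zero.2 hE.volume_ne_zero)
  obtain ⟨R, hR0, hEper, hR⟩ := relPerimeter_subgraph_sub_le hω hφ hAint hη hs ε
  have hq := (hself.le_div hE).trans (ENNReal.div_le_div_right hEper _)
  rw [hPof, hMof, hEvol, ← ENNReal.ofReal_div_of_pos hMpos, ← ENNReal.ofReal_div_of_pos hEpos,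
    ENNReal.ofReal_le_ofReal_iff (div_nonneg hR0 hEpos.le), le_div_iff₀ hEpos, hR] at hq
  exact hq

theorem divergence_horizontalNormal_le (hω : IsOpen ω) (hb : Bornology.IsBounded ω)
    (hφ : ContDiffOn ℝ 2 φ ω) {c : ℝ} (hc : 0 < c) (hcφ : ∀ y ∈ ω, c ≤ φ y)
    (hself : IsSelfCheeger (halfCylinder ω) (subgraph ω φ)) {y₀ : Euc n} (hy₀ : y₀ ∈ ω) :
    divergence (horizontalNormal φ) y₀
      ≤ (relPerimeter (halfCylinder ω) (subgraph ω φ)).toReal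
        / (volume (subgraph ω φ)).toReal := by
  by_contra! hlt
  set h := (relPerimeter (halfCylinder ω) (subgraph ω φ)).toReal
        / (volume (subgraph ω φ)).toReal with hh
  have hV := contDiffOn_horizontalNormal hω hφ
  have hdiv := continuousOn_divergence hω hV
  -- A violation at `y₀` persists on an open set by continuity of the divergence; the variation is
  -- supported there.
  set U := ω ∩ divergence (horizontalNormal φ) ⁻¹' Ioi h with hU
  have hUo : IsOpen U := hdiv.isOpen_inter_preimage hω isOpen_Ioi
  obtain ⟨η, hη, hηs, hηU, hη1, hηI⟩ := exists_cutoff (isCompact_singleton (x := y₀)) hUo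
    (singleton_subset_iff.2 ⟨hy₀, hlt⟩)
  have hηω : tsupport η ⊆ ω := hηU.trans inter_subset_left
  have hηC : ContDiff ℝ 1 η := hη.of_le (by norm_num)
  have hfv := first_variation_le hω ⟨y₀, hy₀⟩ hb hφ hc hcφ hself hηC hηs
    (fun y => (hηI y).1) (fun y => (hηI y).2)
  have hparts := setIntegral_divergence_smul hω hV hηC hηs hηω
  have hDc : Continuous fun y => η y * divergence (horizontalNormal φ) y :=
    contDiff_zero.1 (contDiff_of_tsupport_subset hω
      (contDiffOn_zero.2 (hη.continuous.continuousOn.mul hdiv))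
      ((tsupport_mul_subset_left (f := η)).trans hηω))
  have hDint := hDc.integrable_of_hasCompactSupport (μ := volume) hηs.mul_right
  have hηint := hη.continuous.integrable_of_hasCompactSupport (μ := volume) hηs
  rw [integral_add hDint.integrableOn (integrableOn_inner_horizontalNormal hω hφ hηC hηs)]
    at hparts
  have hzero : ∀ y ∉ ω, η y = 0 := fun y hy =>
    image_eq_zero_of_notMem_tsupport fun h => hy (hηω h)
  rw [setIntegral_eq_integral_of_forall_compl_eq_zero fun y hy => by rw [hzero y hy, zero_mul]]
    at hparts
  rw [setIntegral_eq_integral_of_forall_compl_eq_zero (f := η) hzero] at hfv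
  -- The integrand `η (div V - h)` is nonnegative and strictly positive at `y₀`, whereas the first
  -- variation makes its integral nonpositive.
  have hFpos : 0 < ∫ y, (η y * divergence (horizontalNormal φ) y - h * η y) := by
    refine (hDc.sub (continuous_const.mul
      hη.continuous)).integral_pos_of_hasCompactSupport_nonneg_nonzero
      (hηs.mul_right.sub hηs.mul_left) (fun y => ?_) (x := y₀) ?_
    · by_cases hy : y ∈ tsupport η
      · have h1 : h < divergence (horizontalNormal φ) y := (hηU hy).2
        have h2 := mul_nonneg (hηI y).1 (sub_nonneg.2 h1.le)
        simp only [Pi.zero_apply]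
        linarith
      · simp [image_eq_zero_of_notMem_tsupport hy]
    · have h1 : η y₀ = 1 := (hη1 y₀ rfl).eq_of_nhds
      rw [h1]
      linarith
  rw [integral_sub hDint (hηint.const_mul h), integral_const_mul] at hFpos
  linarith

end Variation

end RelCheeger

open RelCheeger

theorem theorem3p7 (n : ℕ) (hn : 1 ≤ n) (ω : Set (Euc n)) (hω : IsSmoothBoundedDomain ω)
    (φ : Euc n → ℝ) (hφ : ContDiffOn ℝ 2 φ (closure ω)) (hφpos : ∀ y ∈ closure ω, 0 < φ y)
    (horth : MeetsOrthogonally ω φ)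
    (hself : IsSelfCheeger (halfCylinder ω) (subgraph ω φ)) :
    relPerimeter (halfCylinder ω) (subgraph ω φ) ≠ ∞ ∧
    ∀ x ∈ graph ω φ, meanCurvature (graphNormal ω φ) x ≤
      (relPerimeter (halfCylinder ω) (subgraph ω φ)).toReal /
        (n * (volume (subgraph ω φ)).toReal) := by
  have hne : ω.Nonempty := hω.isConnected.nonempty
  have hK : IsCompact (closure ω) := hω.isBounded.isCompact_closure
  -- Positivity up to the boundary gives the uniform lower bound `φ z > 0`, which serves as the
  -- constant `c`.
  obtain ⟨z, hz, hmin⟩ := hK.exists_isMinOn hne.closure hφ.continuousOn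
  have hcφ : ∀ y ∈ ω, φ z ≤ φ y := fun y hy => hmin (subset_closure hy)
  have hφω : ContDiffOn ℝ 2 φ ω := hφ.mono subset_closure
  refine ⟨relPerimeter_subgraph_ne_top hω.isOpen hne hω.isBounded (hφpos z hz) hcφ hself,
    fun x hx => ?_⟩
  have h := divergence_horizontalNormal_le hω.isOpen hω.isBounded hφω (hφpos z hz) hcφ hself hx.1
  rw [← meanCurvature_graphNormal hn hω.isOpen hφω hx.1] at h
  have hn0 : (0 : ℝ) < n := by exact_mod_cast hn
  rwa [mul_comm (n : ℝ) (ENNReal.toReal _), ← div_div, le_div_iff₀ hn0, mul_comm]
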